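/- For a finite group $G$ let $o(g)$ denote the order of $g\in G$ and put $\rho(G)=\prod_{g\in G}o(g)$. If $\rho(G)=p_1^{\alpha_1}\cdots p_k^{\alpha_k}$ with $p_1,\dots,p_k$ distinct primes and all $\alpha_i\ge 1$, let ${\rm Exp}_\rho(G)=\{\alpha_1,\dots,\alpha_k\}$ be the set of exponents in this factorization. Let $\mathbb{Z}_p$ denote the cyclic group of order $p$. **Theorem.** Let $p>5$ be a prime number. Then ${\rm Exp}_\rho({\rm PSL}(2,5)\times\mathbb{Z}_p)=\{15p,\,20p,\,24p,\,60(p-1)\}$, and for every finite group $G$, $$G\cong {\rm PSL}(2,5)\times\mathbb{Z}_p \quad\text{if and only if}\quad {\rm Exp}_\rho(G)={\rm Exp}_\rho({\rm PSL}(2,5)\times\mathbb{Z}_p).$$ -/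

import Mathlib

/-- The product `ρ(G)` of the orders of all elements of a finite group `G`. -/
noncomputable def prodElementOrders (G : Type*) [Group G] : ℕ :=
  ∏ᶠ g : G, orderOf g

/-- `Exp(n)`: the set of exponents occurring in the prime factorization of `n`. -/
def exponentSet (n : ℕ) : Finset ℕ :=
  n.primeFactors.image fun q => n.factorization q

/-- `Exp_ρ(G)`: the set of exponents in the prime factorization of `ρ(G)`. -/
noncomputable def expRho (G : Type*) [Group G] : Finset ℕ :=
  exponentSet (prodElementOrders G)

/-! Write `v q` for the exponent of the prime `q` in `ρ(G)`; it is the sum over `G` of the exponents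
of `q` in the orders of the elements. By Frobenius' theorem the number of `r`-elements of a finite
group is a multiple of the `r`-part of its order. Sorting the elements of `G` by their `r'`-part, it
follows that the `r`-part of `|G|` divides `v q` for all primes `q ≠ r`.

If the exponents are `15p`, `20p`, `24p` and `60(p - 1)`, then the `r`-part of `|G|` divides three
of them; the triples have greatest common divisors `4`, `3`, `5` and `p`, so `|G|` divides `60p`. As
`p` divides `|G|` at most once, `60(p - 1)` counts the elements of order divisible by `p`, which
forces `|G| = 60p`. So many such elements exist only if a Sylow `p`-subgroup `P` is central in its
normalizer, and Burnside's transfer theorem gives a normal complement `K` of order `60`. Since `P`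
normalizes a Sylow `q`-subgroup of `K`, of order less than `p`, for every `q`, it centralizes `K`,
and `G ≃ K × ℤ/p`.

Finally `K` has exponents `15`, `20`, `24`. Their sum `59` is the number of prime factors of `ρ(K)`,
so every nontrivial element of `K` has prime order, and `K` acts faithfully on its five Sylow
`2`-subgroups as the alternating group. The group `PSL(2,5)` has the same two properties: by
Cayley–Hamilton `A² = tA - 1` for `A ∈ SL(2,5)` with trace `t`, and `t² ∈ {0, 1, -1}` makes `A²`,
`A³` or `A⁵` scalar. -/

section PElements

open Nat (totient)

variable {G : Type*} [Group G]

/-- `x` is a `p`-element, that is, killed by some power of `p`; the element-wise version of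
`IsPGroup`. -/
def IsPElement (p : ℕ) (x : G) : Prop :=
  ∃ k, x ^ p ^ k = 1

theorem isPElement_coe {p : ℕ} {H : Subgroup G} {x : H} :
    IsPElement p (x : G) ↔ IsPElement p x := by
  simp only [IsPElement, ← Subgroup.coe_pow, OneMemClass.coe_eq_one]

theorem isPElement_iff_pow_ordProj_eq_one [Finite G] {r : ℕ} (hr : r.Prime) {x : G} :
    IsPElement r x ↔ x ^ ordProj[r] (Nat.card G) = 1 := by
  refine ⟨fun ⟨j, hj⟩ => ?_, fun h => ⟨_, h⟩⟩
  rw [← orderOf_dvd_iff_pow_eq_one] at hj ⊢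
  obtain ⟨i, -, hi⟩ := (Nat.dvd_prime_pow hr).1 hj
  exact hi ▸ (hr.pow_dvd_iff_dvd_ordProj Nat.card_pos.ne').1 (hi ▸ orderOf_dvd_natCard x)

/-- The `r'`-part of an element `x` of a finite group: the power of `x` of order prime to `r` by
which `x` differs from an `r`-element. The exponent is divisible by the `r`-part of the order of
the group and is `1` modulo its `r'`-part. -/
noncomputable def coprimePart (r : ℕ) (x : G) : G :=
  x ^ (ordProj[r] (Nat.card G)) ^ totient (ordCompl[r] (Nat.card G))

theorem coprimePart_conj (r : ℕ) (h g : G) :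
    coprimePart r (h * g * h⁻¹) = h * coprimePart r g * h⁻¹ :=
  conj_pow

theorem commute_coprimePart {r : ℕ} (g : G) : Commute g (coprimePart r g) :=
  (Commute.refl g).pow_right _

theorem card_coprimePart_fiber_conj {r : ℕ} (h y : G) :
    Nat.card {g : G // coprimePart r g = h * y * h⁻¹} =
      Nat.card {g : G // coprimePart r g = y} :=
  (Nat.card_congr ((MulAut.conj h).toEquiv.subtypeEquiv fun g => by
    simp [coprimePart_conj])).symm

variable [Finite G] {r : ℕ}

theorem ordProj_card_dvd_ordProj_pow_totient :
    ordProj[r] (Nat.card G) ∣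
      (ordProj[r] (Nat.card G)) ^ totient (ordCompl[r] (Nat.card G)) :=
  dvd_pow_self _ (Nat.totient_pos.2 (Nat.ordCompl_pos r Nat.card_pos.ne')).ne'

theorem ordProj_pow_totient_modEq_one (hr : r.Prime) :
    (ordProj[r] (Nat.card G)) ^ totient (ordCompl[r] (Nat.card G)) ≡ 1
      [MOD ordCompl[r] (Nat.card G)] :=
  Nat.ModEq.pow_totient ((Nat.coprime_ordCompl hr Nat.card_pos.ne').pow_left _)

theorem coprimePart_pow_ordCompl (g : G) : coprimePart r g ^ ordCompl[r] (Nat.card G) = 1 := by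
  obtain ⟨c, hc⟩ := ordProj_card_dvd_ordProj_pow_totient (G := G) (r := r)
  rw [coprimePart, hc, ← pow_mul, mul_right_comm, Nat.ordProj_mul_ordCompl_eq_self, pow_mul,
    pow_card_eq_one', one_pow]

theorem coprimePart_eq_self (hr : r.Prime) {y : G} (hy : y ^ ordCompl[r] (Nat.card G) = 1) :
    coprimePart r y = y := by
  conv_rhs => rw [← pow_one y]
  exact pow_eq_pow_iff_modEq.2
    ((ordProj_pow_totient_modEq_one hr).of_dvd (orderOf_dvd_of_pow_eq_one hy))

theorem IsPElement.coprimePart_mul (hr : r.Prime) {x y : G} (hx : IsPElement r x)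
    (hxy : Commute x y) : coprimePart r (x * y) = coprimePart r y := by
  have hx1 : coprimePart r x = 1 := orderOf_dvd_iff_pow_eq_one.1
    ((orderOf_dvd_of_pow_eq_one ((isPElement_iff_pow_ordProj_eq_one hr).1 hx)).trans
      ordProj_card_dvd_ordProj_pow_totient)
  rw [coprimePart, hxy.mul_pow, ← coprimePart, hx1, one_mul, coprimePart]

theorem isPElement_mul_inv_coprimePart (hr : r.Prime) (g : G) :
    IsPElement r (g * (coprimePart r g)⁻¹) := by
  rw [isPElement_iff_pow_ordProj_eq_one hr, (commute_coprimePart g).inv_right.mul_pow, inv_pow,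
    mul_inv_eq_one, coprimePart, ← pow_mul, pow_eq_pow_iff_modEq]
  have h := ((ordProj_pow_totient_modEq_one (G := G) hr).mul_right' (ordProj[r] (Nat.card G))).symm
  rw [one_mul, mul_comm (ordCompl[r] _), Nat.ordProj_mul_ordCompl_eq_self] at h
  exact h.of_dvd (orderOf_dvd_natCard g)

theorem card_coprimePart_fiber (hr : r.Prime) {y : G} (hy : y ^ ordCompl[r] (Nat.card G) = 1) :
    Nat.card {g : G // coprimePart r g = y} =
      Nat.card {x : Subgroup.centralizer {y} // IsPElement r x} :=
  Nat.card_congr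
    { toFun := fun ⟨g, hg⟩ =>
        ⟨⟨g * y⁻¹, by
          subst hg
          exact Subgroup.mem_centralizer_singleton_iff.2 ((commute_coprimePart g).mul_left
            (Commute.inv_left (Commute.refl _))).eq⟩, by
          subst hg
          exact isPElement_coe.1 (isPElement_mul_inv_coprimePart hr g)⟩
      invFun := fun ⟨x, hx⟩ =>
        ⟨x * y, by
          rw [(isPElement_coe.2 hx).coprimePart_mul hr
            (Subgroup.mem_centralizer_singleton_iff.1 x.2), coprimePart_eq_self hr hy]⟩
      left_inv := fun g => by simp
      right_inv := fun x => by simp }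

theorem isEmpty_coprimePart_fiber {y : G} (hy : y ^ ordCompl[r] (Nat.card G) ≠ 1) :
    IsEmpty {g : G // coprimePart r g = y} :=
  ⟨fun g => hy (g.2 ▸ coprimePart_pow_ordCompl g.1)⟩

theorem ordProj_card_dvd_index_mul_card_coprimePart_fiber (hr : r.Prime) {y : G}
    (hy : ordProj[r] (Nat.card (Subgroup.centralizer {y})) ∣
      Nat.card {x : Subgroup.centralizer {y} // IsPElement r x}) :
    ordProj[r] (Nat.card G) ∣
      (Subgroup.centralizer {y}).index * Nat.card {g : G // coprimePart r g = y} := by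
  by_cases hym : y ^ ordCompl[r] (Nat.card G) = 1
  · rw [card_coprimePart_fiber hr hym, ← Subgroup.index_mul_card (Subgroup.centralizer {y}),
      Nat.factorization_mul Subgroup.index_ne_zero_of_finite Nat.card_pos.ne', Finsupp.add_apply,
      pow_add]
    exact mul_dvd_mul (Nat.ordProj_dvd _ _) hy
  · have := isEmpty_coprimePart_fiber hym
    simp

end PElements

section ClassSums

variable {G : Type*} [Group G]

theorem card_isConj_eq_index_centralizer (g : G) :
    Nat.card {x : G // IsConj g x} = (Subgroup.centralizer {g}).index := by
  rw [Subgroup.centralizer_eq_comap_stabilizer]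
  refine Eq.trans ?_ (Subgroup.index_comap_of_surjective (MulAction.stabilizer (ConjAct G) g)
    (f := (ConjAct.toConjAct (G := G)).toMonoidHom) (MulEquiv.surjective _)).symm
  rw [MulAction.index_stabilizer, ConjAct.orbit_eq_carrier_conjClasses, ← Nat.card_coe_set_eq]
  exact Nat.card_congr (Equiv.subtypeEquivRight fun x => by
    rw [ConjClasses.mem_carrier_iff_mk_eq, ConjClasses.mk_eq_mk_iff_isConj, isConj_comm])

theorem dvd_sum_of_dvd_index_centralizer_mul [Fintype G] {F : G → ℕ} {d : ℕ}
    (hF : ∀ h g, F (h * g * h⁻¹) = F g)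
    (hd : ∀ g, d ∣ (Subgroup.centralizer {g}).index * F g) : d ∣ ∑ g, F g := by
  classical
  rw [← Finset.sum_fiberwise Finset.univ ConjClasses.mk F]
  refine Finset.dvd_sum fun c _ => ?_
  obtain ⟨a, rfl⟩ := ConjClasses.exists_rep c
  have hclass (x : G) : ConjClasses.mk x = ConjClasses.mk a ↔ IsConj a x := by
    rw [ConjClasses.mk_eq_mk_iff_isConj, isConj_comm]
  simp only [hclass]
  have hconst : ∀ x ∈ Finset.univ.filter (IsConj a), F x = F a := by
    intro x hx
    obtain ⟨h, rfl⟩ := isConj_iff.1 (Finset.mem_filter.1 hx).2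
    exact hF h a
  rw [Finset.sum_congr rfl hconst, Finset.sum_const, smul_eq_mul, ← Fintype.card_subtype,
    ← Nat.card_eq_fintype_card, card_isConj_eq_index_centralizer]
  exact hd a

theorem sum_comp_eq_sum_card_fiber_mul {α β : Type*} [Fintype α] [Fintype β] (π : α → β)
    (f : β → ℕ) : ∑ a, f (π a) = ∑ b, Nat.card {a // π a = b} * f b := by
  classical
  rw [← Finset.sum_fiberwise Finset.univ π]
  refine Finset.sum_congr rfl fun b _ => ?_
  rw [Finset.sum_congr rfl fun a ha => congrArg f (Finset.mem_filter.1 ha).2, Finset.sum_const,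
    smul_eq_mul, ← Fintype.card_subtype, Nat.card_eq_fintype_card]

end ClassSums

section Frobenius

open scoped IsMulCommutative

theorem not_dvd_card_ker_powMonoidHom {A : Type*} [CommGroup A] [Finite A] {r m : ℕ}
    (hr : r.Prime) (hm : ¬r ∣ m) : ¬r ∣ Nat.card (powMonoidHom (α := A) m).ker := by
  have := Fact.mk hr
  intro h
  obtain ⟨z, hz⟩ := exists_prime_orderOf_dvd_card' r h
  exact hm (hz ▸ orderOf_dvd_of_pow_eq_one (Subtype.ext z.2))

variable {G : Type*} [Group G] {r : ℕ}

theorem sum_center_card_coprimePart_fiber [Finite G] [Fintype (Subgroup.center G)]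
    (hr : r.Prime) :
    ∑ z : Subgroup.center G, Nat.card {g : G // coprimePart r g = z} =
      Nat.card (powMonoidHom (α := Subgroup.center G) (ordCompl[r] (Nat.card G))).ker *
        Nat.card {x : G // IsPElement r x} := by
  classical
  have hfiber (z : Subgroup.center G) : Nat.card {g : G // coprimePart r g = z} =
      if z ^ ordCompl[r] (Nat.card G) = 1 then Nat.card {x : G // IsPElement r x} else 0 := by
    split_ifs with hz
    · have htop : Subgroup.centralizer {(z : G)} = ⊤ :=
        Subgroup.centralizer_eq_top_iff_subset.2 (Set.singleton_subset_iff.2 z.2)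
      rw [card_coprimePart_fiber hr (by exact_mod_cast hz), htop]
      exact Nat.card_congr (Subgroup.topEquiv.toEquiv.subtypeEquiv fun x => isPElement_coe.symm)
    · have := isEmpty_coprimePart_fiber (r := r) (y := (z : G)) (by exact_mod_cast hz)
      exact Nat.card_of_isEmpty
  rw [Finset.sum_congr rfl fun z _ => hfiber z, ← Finset.sum_filter, Finset.sum_const,
    smul_eq_mul, ← Fintype.card_subtype, ← Nat.card_eq_fintype_card]
  rfl

theorem ordProj_card_dvd_sum_notMem_center [Fintype G]
    [DecidablePred (· ∈ Subgroup.center G)] (hr : r.Prime)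
    (ih : ∀ y ∉ Subgroup.center G, ordProj[r] (Nat.card (Subgroup.centralizer {y})) ∣
      Nat.card {x : Subgroup.centralizer {y} // IsPElement r x}) :
    ordProj[r] (Nat.card G) ∣
      ∑ y with y ∉ Subgroup.center G, Nat.card {g : G // coprimePart r g = y} := by
  rw [Finset.sum_filter]
  have hnormal : (Subgroup.center G).Normal := inferInstance
  refine dvd_sum_of_dvd_index_centralizer_mul (fun h g => ?_) fun y => ?_
  · have hcenter : h * g * h⁻¹ ∈ Subgroup.center G ↔ g ∈ Subgroup.center G := by
      rw [hnormal.mem_comm_iff, inv_mul_cancel_left]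
    simp only [hcenter, card_coprimePart_fiber_conj]
  · split_ifs with hyc
    · rw [mul_zero]
      exact dvd_zero _
    · exact ordProj_card_dvd_index_mul_card_coprimePart_fiber hr (ih y hyc)

/-- The strong induction passes to centralizers of noncentral elements: sorting the elements of
`G` by their `r'`-part, the noncentral `r'`-parts contribute a multiple of the `r`-part of `|G|`,
and the central ones contribute the number of `r`-elements times a number prime to `r`. -/
theorem ordProj_card_dvd_card_isPElement (hr : r.Prime) (G : Type*) [Group G] [Finite G] :
    ordProj[r] (Nat.card G) ∣ Nat.card {x : G // IsPElement r x} := by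
  induction hn : Nat.card G using Nat.strong_induction_on generalizing G with | h n ih => ?_
  subst hn
  classical
  have := Fintype.ofFinite G
  have hcard : Nat.card G = ∑ z : Subgroup.center G, Nat.card {g : G // coprimePart r g = z} +
      ∑ y with y ∉ Subgroup.center G, Nat.card {g : G // coprimePart r g = y} := by
    rw [← Finset.sum_subtype (Finset.univ.filter (· ∈ Subgroup.center G)) (by simp)
      fun y => Nat.card {g : G // coprimePart r g = y}, Finset.sum_filter_add_sum_filter_not]
    simpa using sum_comp_eq_sum_card_fiber_mul (coprimePart (G := G) r) 1
  have hnoncentral := ordProj_card_dvd_sum_notMem_center (G := G) hr fun y hy => by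
    refine ih _ (lt_of_le_of_ne (Subgroup.card_le_card_group _) fun h => hy ?_) _ rfl
    simpa using Subgroup.centralizer_eq_top_iff_subset.1 (Subgroup.eq_top_of_card_eq _ h)
  have hcentral := (Nat.dvd_add_left hnoncentral).1
    ((Nat.ordProj_dvd (Nat.card G) r).trans hcard.dvd)
  rw [sum_center_card_coprimePart_fiber hr] at hcentral
  refine (Nat.Coprime.pow_left _ (hr.coprime_iff_not_dvd.2 ?_)).dvd_of_dvd_mul_left hcentral
  exact not_dvd_card_ker_powMonoidHom (A := Subgroup.center G) hr
    (Nat.not_dvd_ordCompl hr Nat.card_pos.ne')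

end Frobenius

section ProdElementOrders

open Finset

variable {G : Type*} [Group G]

theorem prodElementOrders_eq_prod (G : Type*) [Group G] [Fintype G] :
    prodElementOrders G = ∏ g : G, orderOf g :=
  finprod_eq_prod_of_fintype _

theorem prodElementOrders_congr {H : Type*} [Group H] (e : G ≃* H) :
    prodElementOrders G = prodElementOrders H :=
  finprod_eq_of_bijective e e.bijective fun g => (e.orderOf_eq g).symm

theorem expRho_congr {H : Type*} [Group H] (e : G ≃* H) : expRho G = expRho H := by
  rw [expRho, expRho, prodElementOrders_congr e]

theorem prodElementOrders_ne_zero (G : Type*) [Group G] [Finite G] : prodElementOrders G ≠ 0 := by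
  have := Fintype.ofFinite G
  rw [prodElementOrders_eq_prod]
  exact prod_ne_zero_iff.2 fun g _ => (orderOf_pos g).ne'

theorem factorization_prodElementOrders [Fintype G] (q : ℕ) :
    (prodElementOrders G).factorization q = ∑ g : G, (orderOf g).factorization q := by
  rw [prodElementOrders_eq_prod, Nat.factorization_prod fun g _ => (orderOf_pos g).ne',
    Finset.sum_apply']

theorem prime_dvd_prodElementOrders_iff [Finite G] {q : ℕ} (hq : q.Prime) :
    q ∣ prodElementOrders G ↔ q ∣ Nat.card G := by
  have := Fintype.ofFinite G
  have := Fact.mk hq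
  rw [prodElementOrders_eq_prod, hq.prime.dvd_finsetProd_iff]
  refine ⟨fun ⟨g, _, hg⟩ => hg.trans (orderOf_dvd_natCard g), fun h => ?_⟩
  obtain ⟨g, hg⟩ := exists_prime_orderOf_dvd_card' q h
  exact ⟨g, mem_univ g, hg.symm.dvd⟩

theorem primeFactors_prodElementOrders (G : Type*) [Group G] [Finite G] :
    (prodElementOrders G).primeFactors = (Nat.card G).primeFactors := by
  ext q
  rw [Nat.mem_primeFactors_of_ne_zero (prodElementOrders_ne_zero G),
    Nat.mem_primeFactors_of_ne_zero Nat.card_pos.ne']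
  exact and_congr_right prime_dvd_prodElementOrders_iff

theorem factorization_prodElementOrders_pos [Finite G] {q : ℕ} (hq : q.Prime)
    (h : q ∣ Nat.card G) : 0 < (prodElementOrders G).factorization q :=
  hq.factorization_pos_of_dvd (prodElementOrders_ne_zero G)
    ((prime_dvd_prodElementOrders_iff hq).2 h)

theorem expRho_eq_image (G : Type*) [Group G] [Finite G] :
    expRho G = (Nat.card G).primeFactors.image (prodElementOrders G).factorization := by
  rw [expRho, exponentSet, primeFactors_prodElementOrders]

theorem factorization_prodElementOrders_prod {K Z : Type*} [Group K] [Group Z] [Finite K]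
    [Finite Z] {q : ℕ} (hq : ¬q ∣ Nat.card Z) :
    (prodElementOrders (K × Z)).factorization q =
      Nat.card Z * (prodElementOrders K).factorization q := by
  have := Fintype.ofFinite K
  have := Fintype.ofFinite Z
  have horder (k : K) (z : Z) :
      (orderOf (k, z)).factorization q = (orderOf k).factorization q := by
    rw [Prod.orderOf_mk, Nat.factorization_lcm (orderOf_pos k).ne' (orderOf_pos z).ne',
      Finsupp.sup_apply,
      Nat.factorization_eq_zero_of_not_dvd fun h => hq (h.trans (orderOf_dvd_natCard z))]
    exact Nat.max_zero _
  simp only [factorization_prodElementOrders, Fintype.sum_prod_type, horder, sum_const, card_univ,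
    smul_eq_mul, ← mul_sum, Nat.card_eq_fintype_card]

theorem factorization_prodElementOrders_eq_card [Finite G] {p : ℕ} (hp : p.Prime)
    (h : (Nat.card G).factorization p ≤ 1) :
    (prodElementOrders G).factorization p = Nat.card {g : G // p ∣ orderOf g} := by
  classical
  have := Fintype.ofFinite G
  rw [factorization_prodElementOrders, Nat.card_eq_fintype_card, Fintype.card_subtype,
    card_filter]
  refine sum_congr rfl fun g _ => ?_
  split_ifs with hg
  · exact le_antisymm (((Nat.factorization_le_iff_dvd (orderOf_pos g).ne' Nat.card_pos.ne').2
      (orderOf_dvd_natCard g) p).trans h) (hp.factorization_pos_of_dvd (orderOf_pos g).ne' hg)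
  · exact Nat.factorization_eq_zero_of_not_dvd hg

theorem factorization_prodElementOrders_of_card_eq_prime {p : ℕ} (hp : p.Prime)
    (hG : Nat.card G = p) : (prodElementOrders G).factorization p = p - 1 := by
  classical
  have : Finite G := Nat.finite_of_card_ne_zero (by rw [hG]; exact hp.ne_zero)
  have := Fintype.ofFinite G
  have hdvd (g : G) : p ∣ orderOf g ↔ ¬g = 1 := by
    have : orderOf g = 1 ∨ orderOf g = p :=
      (Nat.dvd_prime hp).1 (hG ▸ orderOf_dvd_natCard g)
    rw [← orderOf_eq_one_iff]
    rcases this with h | h <;> simp [h, hp.ne_one]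
  rw [factorization_prodElementOrders_eq_card hp (by rw [hG, hp.factorization_self])]
  simp only [hdvd]
  rw [Nat.card_eq_fintype_card, Fintype.card_subtype_compl, Fintype.card_subtype_eq,
    ← Nat.card_eq_fintype_card, hG]

end ProdElementOrders

section Divisibility

variable {G : Type*} [Group G]

theorem ordProj_card_dvd_sum_of_coprimePart_invariant [Fintype G] {r : ℕ} (hr : r.Prime)
    {f : G → ℕ} (hconj : ∀ h g, f (h * g * h⁻¹) = f g) (hf : ∀ g, f (coprimePart r g) = f g) :
    ordProj[r] (Nat.card G) ∣ ∑ g, f g := by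
  rw [← Finset.sum_congr rfl fun g _ => hf g, sum_comp_eq_sum_card_fiber_mul]
  refine dvd_sum_of_dvd_index_centralizer_mul
    (fun h g => by rw [card_coprimePart_fiber_conj, hconj]) fun y => ?_
  rw [← mul_assoc]
  exact (ordProj_card_dvd_index_mul_card_coprimePart_fiber hr
    (ordProj_card_dvd_card_isPElement hr _)).mul_right _

theorem factorization_orderOf_coprimePart [Finite G] {r q : ℕ} (hr : r.Prime) (hq : q.Prime)
    (hrq : r ≠ q) (g : G) :
    (orderOf (coprimePart r g)).factorization q = (orderOf g).factorization q := by
  rw [coprimePart, orderOf_pow, Nat.factorization_div (Nat.gcd_dvd_left _ _), Finsupp.coe_tsub,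
    Pi.sub_apply, Nat.factorization_eq_zero_of_not_dvd (n := Nat.gcd _ _), Nat.sub_zero]
  exact fun h => hrq ((Nat.prime_dvd_prime_iff_eq hq hr).1
    (hq.dvd_of_dvd_pow (hq.dvd_of_dvd_pow (h.trans (Nat.gcd_dvd_right _ _))))).symm

theorem ordProj_card_dvd_factorization_prodElementOrders [Finite G] {r q : ℕ} (hr : r.Prime)
    (hq : q.Prime) (hrq : r ≠ q) :
    ordProj[r] (Nat.card G) ∣ (prodElementOrders G).factorization q := by
  have := Fintype.ofFinite G
  rw [factorization_prodElementOrders]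
  exact ordProj_card_dvd_sum_of_coprimePart_invariant hr
    (fun h g => by rw [← MulAut.conj_apply, MulEquiv.orderOf_eq])
    (factorization_orderOf_coprimePart hr hq hrq)

theorem dvd_factorization_prodElementOrders [Finite G] {q d : ℕ} (hq : q.Prime)
    (hd : d ∣ Nat.card G) (hqd : ¬q ∣ d) : d ∣ (prodElementOrders G).factorization q := by
  refine (Nat.dvd_iff_prime_pow_dvd_dvd _ _).2 fun r k hr hrk => ?_
  rcases eq_or_ne k 0 with rfl | hk
  · exact one_dvd _
  have hrq : r ≠ q := by
    rintro rfl
    exact hqd ((dvd_pow_self r hk).trans hrk)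
  exact ((hr.pow_dvd_iff_dvd_ordProj Nat.card_pos.ne').1 (hrk.trans hd)).trans
    (ordProj_card_dvd_factorization_prodElementOrders hr hq hrq)

end Divisibility

section PrimeOrders

open Finset ArithmeticFunction

variable {K : Type*} [Group K]

theorem cardFactors_prodElementOrders (K : Type*) [Group K] [Fintype K] :
    cardFactors (prodElementOrders K) = ∑ x : K, cardFactors (orderOf x) := by
  have hne := prodElementOrders_ne_zero K
  rw [prodElementOrders_eq_prod] at hne ⊢
  rw [prod_eq_multiset_prod, cardFactors_multiset_prod hne, Multiset.map_map]
  rfl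

theorem orderOf_prime_iff_cardFactors_prodElementOrders [Finite K] :
    (∀ x : K, x ≠ 1 → (orderOf x).Prime) ↔
      cardFactors (prodElementOrders K) + 1 = Nat.card K := by
  classical
  have := Fintype.ofFinite K
  have hpos : ∀ x ∈ univ.erase (1 : K), 1 ≤ cardFactors (orderOf x) := by
    intro x hx
    rw [Nat.one_le_iff_ne_zero, ne_eq, cardFactors_eq_zero_iff_eq_zero_or_one, orderOf_eq_one_iff]
    exact not_or_intro (orderOf_pos x).ne' (ne_of_mem_erase hx)
  have hsum : Nat.card K = ∑ x ∈ univ.erase (1 : K), 1 + 1 := by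
    rw [sum_const, smul_eq_mul, mul_one, card_erase_add_one (mem_univ _), card_univ,
      Nat.card_eq_fintype_card]
  rw [cardFactors_prodElementOrders, ← sum_erase univ (a := (1 : K)) (by simp), hsum,
    add_left_inj, eq_comm, sum_eq_sum_iff_of_le hpos]
  simp only [mem_erase, mem_univ, and_true, eq_comm (a := 1), cardFactors_eq_one_iff_prime]

theorem primeFactors_sixty : Nat.primeFactors 60 = {2, 3, 5} := by
  simp [Nat.primeFactors]

theorem cardFactors_prodElementOrders_of_card_eq_sixty (hK : Nat.card K = 60) :
    cardFactors (prodElementOrders K) = (prodElementOrders K).factorization 2 +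
      (prodElementOrders K).factorization 3 + (prodElementOrders K).factorization 5 := by
  have : Finite K := Nat.finite_of_card_ne_zero (by rw [hK]; norm_num)
  rw [cardFactors_eq_sum_factorization, Finsupp.sum, Nat.support_factorization,
    primeFactors_prodElementOrders, hK, primeFactors_sixty]
  simp [add_assoc]

theorem factorization_prodElementOrders_iff_orderOf_prime (hK : Nat.card K = 60) :
    ((prodElementOrders K).factorization 2 = 15 ∧ (prodElementOrders K).factorization 3 = 20 ∧
      (prodElementOrders K).factorization 5 = 24) ↔ ∀ x : K, x ≠ 1 → (orderOf x).Prime := by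
  have : Finite K := Nat.finite_of_card_ne_zero (by rw [hK]; norm_num)
  rw [orderOf_prime_iff_cardFactors_prodElementOrders, hK,
    cardFactors_prodElementOrders_of_card_eq_sixty hK]
  refine ⟨by omega, fun hsum => ?_⟩
  have h2 := factorization_prodElementOrders_pos (G := K) Nat.prime_two (hK ▸ by norm_num)
  have h3 := factorization_prodElementOrders_pos (G := K) Nat.prime_three (hK ▸ by norm_num)
  have h5 := factorization_prodElementOrders_pos (G := K) Nat.prime_five (hK ▸ by norm_num)
  have d2 := dvd_factorization_prodElementOrders (G := K) (d := 15) Nat.prime_two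
    (hK ▸ by norm_num) (by norm_num)
  have d3 := dvd_factorization_prodElementOrders (G := K) (d := 20) Nat.prime_three
    (hK ▸ by norm_num) (by norm_num)
  have d5 := dvd_factorization_prodElementOrders (G := K) (d := 12) Nat.prime_five
    (hK ▸ by norm_num) (by norm_num)
  omega

end PrimeOrders

section PrimeOrderElements

variable {K : Type*} [Group K]

theorem orderOf_eq_of_commute (hprime : ∀ x : K, x ≠ 1 → (orderOf x).Prime) {x y : K}
    (hx : x ≠ 1) (hy : y ≠ 1) (h : Commute x y) : orderOf x = orderOf y := by
  by_contra hne
  have hmul := h.orderOf_mul_eq_mul_orderOf_of_coprime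
    ((Nat.coprime_primes (hprime x hx) (hprime y hy)).2 hne)
  have hxy : x * y ≠ 1 := by
    rw [Ne, ← orderOf_eq_one_iff, hmul, mul_eq_one]
    exact fun h1 => (hprime x hx).ne_one h1.1
  exact Nat.not_prime_mul (hprime x hx).ne_one (hprime y hy).ne_one (hmul ▸ hprime _ hxy)

theorem card_orderOf_eq_factorization_prodElementOrders [Finite K]
    (hprime : ∀ x : K, x ≠ 1 → (orderOf x).Prime) {q : ℕ} (hq : q.Prime) :
    Nat.card {x : K // orderOf x = q} = (prodElementOrders K).factorization q := by
  classical
  have := Fintype.ofFinite K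
  rw [factorization_prodElementOrders, Nat.card_eq_fintype_card, Fintype.card_subtype,
    Finset.card_filter]
  refine Finset.sum_congr rfl fun x _ => ?_
  rcases eq_or_ne x 1 with rfl | hx
  · simp [hq.ne_one.symm]
  · rw [(hprime x hx).factorization, Finsupp.single_apply]

variable {q : ℕ} [Fact q.Prime]

theorem orderOf_eq_of_mem_isPGroup (hprime : ∀ x : K, x ≠ 1 → (orderOf x).Prime)
    {H : Subgroup K} (hH : IsPGroup q H) {x : K} (hx : x ∈ H) (hx1 : x ≠ 1) : orderOf x = q := by
  obtain ⟨k, hk⟩ := IsPGroup.iff_orderOf.1 hH ⟨x, hx⟩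
  rw [Subgroup.orderOf_mk] at hk
  exact (Nat.prime_dvd_prime_iff_eq (hprime x hx1) Fact.out).1
    ((hprime x hx1).dvd_of_dvd_pow hk.dvd)

theorem centralizer_singleton_eq_sylow (hprime : ∀ x : K, x ≠ 1 → (orderOf x).Prime)
    {V : Sylow q K} [IsMulCommutative V] {x : K} (hx : x ∈ V) (hx1 : x ≠ 1) :
    Subgroup.centralizer {x} = V := by
  refine V.is_maximal' (IsPGroup.iff_orderOf.2 fun ⟨y, hy⟩ => ?_)
    ((Subgroup.le_centralizer (V : Subgroup K)).trans
      (Subgroup.centralizer_le (Set.singleton_subset_iff.2 hx)))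
  rw [Subgroup.orderOf_mk]
  rcases eq_or_ne y 1 with rfl | hy1
  · exact ⟨0, by simp⟩
  · exact ⟨1, by rw [pow_one, orderOf_eq_of_commute hprime hy1 hx1
      (Subgroup.mem_centralizer_singleton_iff.1 hy),
      orderOf_eq_of_mem_isPGroup hprime V.isPGroup' hx hx1]⟩

variable [∀ V : Sylow q K, IsMulCommutative V]

theorem sylow_eq_of_mem (hprime : ∀ x : K, x ≠ 1 → (orderOf x).Prime) {V W : Sylow q K} {x : K}
    (hV : x ∈ V) (hW : x ∈ W) (hx1 : x ≠ 1) : V = W :=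
  Sylow.ext ((centralizer_singleton_eq_sylow hprime hV hx1).symm.trans
    (centralizer_singleton_eq_sylow hprime hW hx1))

theorem card_orderOf_eq_card_sylow_mul [Finite K] (hprime : ∀ x : K, x ≠ 1 → (orderOf x).Prime) :
    Nat.card {x : K // orderOf x = q} =
      Nat.card (Sylow q K) * (ordProj[q] (Nat.card K) - 1) := by
  classical
  have := Fintype.ofFinite (Sylow q K)
  let f : (Σ V : Sylow q K, {x : V // x ≠ 1}) → {x : K // orderOf x = q} := fun s =>
    ⟨s.2.1, orderOf_eq_of_mem_isPGroup hprime s.1.isPGroup' s.2.1.2 (by exact_mod_cast s.2.2)⟩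
  have hf : Function.Bijective f := by
    constructor
    · rintro ⟨V, ⟨x, hx⟩, hx1⟩ ⟨W, ⟨y, hy⟩, hy1⟩ h
      obtain rfl : x = y := congrArg Subtype.val h
      obtain rfl : V = W := sylow_eq_of_mem hprime hx hy fun h => hx1 (Subtype.ext h)
      rfl
    · rintro ⟨x, hx⟩
      have hzpowers : IsPGroup q (Subgroup.zpowers x) :=
        IsPGroup.of_card (n := 1) (by rw [Nat.card_zpowers, hx, pow_one])
      obtain ⟨V, hV⟩ := hzpowers.exists_le_sylow
      refine ⟨⟨V, ⟨x, hV (Subgroup.mem_zpowers x)⟩, fun h => ?_⟩, rfl⟩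
      obtain rfl : x = 1 := congrArg Subtype.val h
      exact (Fact.out : q.Prime).ne_one (by rw [← hx, orderOf_one])
  have hV (V : Sylow q K) : Nat.card {x : V // x ≠ 1} = ordProj[q] (Nat.card K) - 1 := by
    have := Fintype.ofFinite V
    rw [← V.card_eq_multiplicity, Nat.card_eq_fintype_card, Fintype.card_subtype_compl,
      Fintype.card_subtype_eq, ← Nat.card_eq_fintype_card]
    rfl
  rw [← Nat.card_congr (Equiv.ofBijective f hf), Nat.card_sigma,
    Finset.sum_congr rfl fun V _ => hV V, Finset.sum_const, Finset.card_univ,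
    ← Nat.card_eq_fintype_card, smul_eq_mul]

/-- An element of the kernel normalizes every Sylow subgroup. If it lies in one of them it lies in
all of them, hence is trivial; so the kernel meets each Sylow subgroup trivially, and being normal
it commutes with it. -/
theorem toPermHom_sylow_injective [Finite K] [Nontrivial (Sylow q K)]
    (hprime : ∀ x : K, x ≠ 1 → (orderOf x).Prime) :
    Function.Injective (MulAction.toPermHom K (Sylow q K)) := by
  set M := (MulAction.toPermHom K (Sylow q K)).ker
  obtain ⟨V, W, hVW⟩ := exists_pair_ne (Sylow q K)
  have hnormalizer {m : K} (hm : m ∈ M) (U : Sylow q K) : m ∈ Subgroup.normalizer (U : Set K) :=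
    Sylow.smul_eq_iff_mem_normalizer.1 (Equiv.congr_fun (MonoidHom.mem_ker.1 hm) U)
  have hdisjoint {m : K} (hm : m ∈ M) (hmV : m ∈ V) : m = 1 := by
    by_contra hm1
    have hzpowers : IsPGroup q (Subgroup.zpowers m) :=
      V.isPGroup'.to_le (Subgroup.zpowers_le.2 (show m ∈ (V : Subgroup K) from hmV))
    have hmW : m ∈ Subgroup.zpowers m ⊓ (W : Subgroup K) :=
      hzpowers.inf_normalizer_sylow W ▸ ⟨Subgroup.mem_zpowers m, hnormalizer hm W⟩
    exact hVW (sylow_eq_of_mem hprime hmV hmW.2 hm1)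
  obtain ⟨v, hv, hv1⟩ : ∃ v ∈ V, v ≠ 1 := by
    by_contra! hbot
    have hle : (V : Subgroup K) ≤ W := fun x hx => hbot x hx ▸ one_mem W
    exact hVW (Sylow.ext (V.is_maximal' W.isPGroup' hle).symm)
  rw [← MonoidHom.ker_eq_bot_iff, Subgroup.eq_bot_iff_forall]
  intro m hm
  have hcommutator : m * v * m⁻¹ * v⁻¹ = 1 := by
    refine hdisjoint ?_
      (mul_mem ((Subgroup.mem_normalizer_iff.1 (hnormalizer hm V) v).1 hv) (inv_mem hv))
    have hconj : v * m⁻¹ * v⁻¹ ∈ M := (MonoidHom.normal_ker _).conj_mem _ (inv_mem hm) v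
    simpa only [mul_assoc] using mul_mem hm hconj
  refine hdisjoint hm ?_
  change m ∈ (V : Subgroup K)
  rw [← centralizer_singleton_eq_sylow hprime hv hv1, Subgroup.mem_centralizer_singleton_iff]
  exact mul_inv_eq_iff_eq_mul.1 (mul_inv_eq_one.1 hcommutator)

end PrimeOrderElements

section AlternatingGroupFive

variable {K : Type*} [Group K]

theorem ordProj_two_sixty : ordProj[2] 60 = 4 := by
  decide +kernel

theorem isMulCommutative_sylow_two (hK : Nat.card K = 60) (V : Sylow 2 K) :
    IsMulCommutative V := by
  have : Finite K := Nat.finite_of_card_ne_zero (by omega)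
  refine IsPGroup.isMulCommutative_of_card_eq_prime_sq (p := 2) ?_
  rw [V.card_eq_multiplicity, hK, ordProj_two_sixty]
  rfl

theorem card_sylow_two_eq_five (hK : Nat.card K = 60)
    (hprime : ∀ x : K, x ≠ 1 → (orderOf x).Prime) : Nat.card (Sylow 2 K) = 5 := by
  have : Finite K := Nat.finite_of_card_ne_zero (by omega)
  have := isMulCommutative_sylow_two hK
  have hcard := card_orderOf_eq_card_sylow_mul (q := 2) hprime
  rw [card_orderOf_eq_factorization_prodElementOrders hprime Nat.prime_two,
    ((factorization_prodElementOrders_iff_orderOf_prime hK).2 hprime).1, hK,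
    ordProj_two_sixty] at hcard
  omega

theorem nonempty_mulEquiv_alternatingGroup_five (hK : Nat.card K = 60)
    (hprime : ∀ x : K, x ≠ 1 → (orderOf x).Prime) :
    Nonempty (K ≃* alternatingGroup (Fin 5)) := by
  classical
  have : Finite K := Nat.finite_of_card_ne_zero (by omega)
  have := Fintype.ofFinite (Sylow 2 K)
  have := isMulCommutative_sylow_two hK
  have hfive := card_sylow_two_eq_five hK hprime
  have : Nontrivial (Sylow 2 K) := Finite.one_lt_card_iff_nontrivial.1 (by omega)
  let e := MonoidHom.ofInjective (toPermHom_sylow_injective (q := 2) hprime)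
  have hindex : (MulAction.toPermHom K (Sylow 2 K)).range.index = 2 := by
    have h := Subgroup.index_mul_card (MulAction.toPermHom K (Sylow 2 K)).range
    rw [← Nat.card_congr e.toEquiv, hK, Nat.card_perm, hfive,
      show Nat.factorial 5 = 120 from rfl] at h
    omega
  exact ⟨(e.trans (MulEquiv.subgroupCongr
    (Equiv.Perm.eq_alternatingGroup_of_index_eq_two hindex))).trans
      (Equiv.altCongrHom (Finite.equivFinOfCardEq hfive))⟩

end AlternatingGroupFive

section ProjectiveSpecialLinearGroup

open Matrix

theorem range_toGL {n R : Type*} [Fintype n] [DecidableEq n] [CommRing R] :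
    (SpecialLinearGroup.toGL (n := n) (R := R)).range = (GeneralLinearGroup.det).ker := by
  ext g
  rw [MonoidHom.mem_range, MonoidHom.mem_ker]
  refine ⟨?_, fun h => ⟨⟨g, congrArg Units.val h⟩, Units.ext rfl⟩⟩
  rintro ⟨A, rfl⟩
  exact SpecialLinearGroup.coeToGL_det A

section Field

variable {F : Type*} [Field F]

theorem card_specialLinearGroup_mul_card_units {n : Type*} [Fintype n] [DecidableEq n]
    [Nonempty n] :
    Nat.card (SpecialLinearGroup n F) * Nat.card Fˣ = Nat.card (GL n F) := by
  rw [Nat.card_congr (MonoidHom.ofInjective SpecialLinearGroup.toGL_injective).toEquiv, range_toGL,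
    ← Subgroup.card_mul_index (GeneralLinearGroup.det (n := n) (R := F)).ker,
    Subgroup.index_ker, MonoidHom.range_eq_top.2 GeneralLinearGroup.det_surjective,
    Subgroup.card_top]

theorem card_specialLinearGroup_two [Finite F] :
    Nat.card (SpecialLinearGroup (Fin 2) F) = Nat.card F * (Nat.card F ^ 2 - 1) := by
  have := Fintype.ofFinite F
  have hunits : 0 < Nat.card Fˣ := Nat.card_pos
  have hGL := card_specialLinearGroup_mul_card_units (F := F) (n := Fin 2)
  rw [card_GL_field, Fin.prod_univ_two, ← Nat.card_eq_fintype_card] at hGL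
  simp only [Fin.coe_ofNat_eq_mod, Nat.zero_mod, pow_zero, Nat.mod_succ, pow_one] at hGL
  refine Nat.eq_of_mul_eq_mul_right hunits (hGL.trans ?_)
  rw [Nat.card_units, sq, ← Nat.mul_sub_one]
  ring

theorem card_center_specialLinearGroup_two (hF : ringChar F ≠ 2) :
    Nat.card (Subgroup.center (SpecialLinearGroup (Fin 2) F)) = 2 := by
  rw [Nat.card_congr (SpecialLinearGroup.center_equiv_rootsOfUnity' (0 : Fin 2)).toEquiv,
    Fintype.card_fin]
  exact (IsPrimitiveRoot.neg_one (R := F) (ringChar F) hF).card_rootsOfUnity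

theorem card_projectiveSpecialLinearGroup_two [Finite F] (hF : ringChar F ≠ 2) :
    Nat.card (ProjectiveSpecialLinearGroup (Fin 2) F) =
      Nat.card F * (Nat.card F ^ 2 - 1) / 2 := by
  rw [← Subgroup.index_eq_card, ← card_specialLinearGroup_two, ← Subgroup.index_mul_card
    (Subgroup.center (SpecialLinearGroup (Fin 2) F)), card_center_specialLinearGroup_two hF,
    Nat.mul_div_cancel _ two_pos]

end Field

section CommRing

variable {R : Type*} [CommRing R]

theorem sq_eq_trace_smul_sub_one (A : SpecialLinearGroup (Fin 2) R) :
    (A : Matrix (Fin 2) (Fin 2) R) ^ 2 =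
      (A : Matrix (Fin 2) (Fin 2) R).trace • (A : Matrix (Fin 2) (Fin 2) R) - 1 := by
  nontriviality R
  have h := aeval_self_charpoly (A : Matrix (Fin 2) (Fin 2) R)
  rw [charpoly_fin_two, A.det_coe] at h
  simp only [map_add, map_sub, map_mul, map_pow, Polynomial.aeval_X, Polynomial.aeval_C, map_one,
    ← Algebra.smul_def] at h
  rw [← sub_eq_zero, ← h]
  abel

theorem pow_three_of_sq_eq {S : Type*} [Ring S] [Algebra R S] {t : R} {x : S}
    (h : x ^ 2 = t • x - 1) : x ^ 3 = (t ^ 2 - 1) • x - t • (1 : S) := by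
  rw [pow_succ, h, sub_mul, smul_mul_assoc, ← sq, h, one_mul]
  module

theorem pow_five_of_sq_eq {S : Type*} [Ring S] [Algebra R S] {t : R} {x : S}
    (h : x ^ 2 = t • x - 1) :
    x ^ 5 = (t ^ 4 - 3 * t ^ 2 + 1) • x - (t ^ 3 - 2 * t) • (1 : S) := by
  rw [pow_add x 3 2, pow_three_of_sq_eq h, h]
  simp only [sub_mul, mul_sub, ← sq, h, mul_one, one_mul, smul_mul_assoc, mul_smul_comm]
  module

theorem mem_center_of_coe_eq_smul_one {A : SpecialLinearGroup (Fin 2) R} {r : R}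
    (h : (A : Matrix (Fin 2) (Fin 2) R) = r • (1 : Matrix (Fin 2) (Fin 2) R)) :
    A ∈ Subgroup.center (SpecialLinearGroup (Fin 2) R) := by
  refine Matrix.SpecialLinearGroup.mem_center_iff.2 ⟨r, ?_, ?_⟩
  · rw [← A.det_coe, h, Matrix.det_smul, det_one, mul_one]
  · rw [h, scalar_apply, smul_one_eq_diagonal]

end CommRing

theorem card_projectiveSpecialLinearGroup_two_five :
    Nat.card (ProjectiveSpecialLinearGroup (Fin 2) (ZMod 5)) = 60 := by
  have := Fact.mk Nat.prime_five
  have hchar : ringChar (ZMod 5) ≠ 2 := by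
    rw [ZMod.ringChar_zmod_n]
    decide
  have hcard := card_projectiveSpecialLinearGroup_two hchar
  rwa [Nat.card_zmod] at hcard

theorem exists_prime_pow_mem_center (A : SpecialLinearGroup (Fin 2) (ZMod 5)) :
    ∃ k : ℕ, k.Prime ∧ A ^ k ∈ Subgroup.center (SpecialLinearGroup (Fin 2) (ZMod 5)) := by
  have hsq := sq_eq_trace_smul_sub_one A
  set t := (A : Matrix (Fin 2) (Fin 2) (ZMod 5)).trace
  have ht : t = 0 ∨ t ^ 2 = 1 ∨ t ^ 2 = -1 := by
    generalize t = t
    decide +revert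
  rcases ht with ht | ht | ht
  · refine ⟨2, Nat.prime_two, mem_center_of_coe_eq_smul_one (r := -1)
      ((Matrix.SpecialLinearGroup.coe_pow A 2).trans ?_)⟩
    rw [hsq, ht]
    module
  · refine ⟨3, Nat.prime_three, mem_center_of_coe_eq_smul_one (r := -t)
      ((Matrix.SpecialLinearGroup.coe_pow A 3).trans ?_)⟩
    rw [pow_three_of_sq_eq hsq, ht]
    module
  · refine ⟨5, Nat.prime_five, mem_center_of_coe_eq_smul_one (r := 3 * t)
      ((Matrix.SpecialLinearGroup.coe_pow A 5).trans ?_)⟩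
    have h0 : t ^ 4 - 3 * t ^ 2 + 1 = 0 := by
      rw [show t ^ 4 = (t ^ 2) ^ 2 by ring, ht]
      decide
    have h3 : t ^ 3 - 2 * t = -(3 * t) := by
      rw [pow_succ, ht]
      ring
    rw [pow_five_of_sq_eq hsq, h0, h3]
    module

theorem orderOf_prime_projectiveSpecialLinearGroup_two_five
    (x : ProjectiveSpecialLinearGroup (Fin 2) (ZMod 5)) (hx : x ≠ 1) : (orderOf x).Prime := by
  induction x using QuotientGroup.induction_on with | H A => ?_
  obtain ⟨k, hk, hA⟩ := exists_prime_pow_mem_center A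
  have := Fact.mk hk
  rw [orderOf_eq_prime ((QuotientGroup.eq_one_iff (A ^ k)).2 hA) hx]
  exact hk

end ProjectiveSpecialLinearGroup

section CentralizingSubgroups

open Subgroup

variable {G : Type*} [Group G] {p : ℕ} [Fact p.Prime]

/-- The action of `A` on `H` by conjugation is by permutations of fewer than `p` points, so its
image is a `p`-group of order dividing a factorial prime to `p`. -/
theorem le_centralizer_of_le_normalizer_of_card_lt {A H : Subgroup G} [Finite H]
    (hA : IsPGroup p A) (hAH : A ≤ normalizer (H : Set G)) (hH : Nat.card H < p) :
    A ≤ centralizer (H : Set G) := by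
  let φ : A →* Equiv.Perm H :=
    (MulAction.toPermHom (MulAut H) H).comp ((normalizerMonoidHom H).comp (inclusion hAH))
  intro a ha
  obtain ⟨k, hk⟩ := IsPGroup.iff_orderOf.1 hA ⟨a, ha⟩
  have hcoprime : Nat.Coprime (p ^ k) (Nat.card (Equiv.Perm H)) := by
    rw [Nat.card_perm]
    exact ((Fact.out : p.Prime).coprime_factorial_of_lt hH).pow_left _
  have hφ : φ ⟨a, ha⟩ = 1 := by
    rw [← orderOf_eq_one_iff]
    exact Nat.eq_one_of_dvd_coprimes hcoprime (hk ▸ orderOf_map_dvd φ _) (orderOf_dvd_natCard _)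
  refine mem_centralizer_iff.2 fun h hh => ?_
  have hconj : a * h * a⁻¹ = h := congrArg Subtype.val (Equiv.congr_fun hφ ⟨h, hh⟩)
  exact (mul_inv_eq_iff_eq_mul.1 hconj).symm

theorem not_dvd_of_ordProj_lt {n : ℕ} (hn : n ≠ 0) (h : ordProj[p] n < p) : ¬p ∣ n := fun hpn =>
  h.not_ge (Nat.le_of_dvd (Nat.ordProj_pos n p) (Nat.dvd_ordProj_of_dvd hn Fact.out hpn))

theorem card_sylow_dvd_card {q : ℕ} [Fact q.Prime] [Finite G] :
    Nat.card (Sylow q G) ∣ Nat.card G := by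
  obtain ⟨Q⟩ : Nonempty (Sylow q G) := inferInstance
  exact Q.card_dvd_index.trans (index_dvd_card _)

open scoped Pointwise in
theorem exists_sylow_le_normalizer_map {P K : Subgroup G} [K.Normal] [Finite K]
    (hP : IsPGroup p P) (hpK : ¬p ∣ Nat.card K) (q : ℕ) [Fact q.Prime] :
    ∃ Q : Sylow q K, P ≤ normalizer (((Q : Subgroup K).map K.subtype : Subgroup G) : Set G) := by
  obtain ⟨Q, hQ⟩ := (hP.map (MulAut.conjNormal (H := K))).nonempty_fixed_point_of_prime_not_dvd_card
    (Sylow q K) fun h => hpK (h.trans card_sylow_dvd_card)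
  have hconj : ∀ x ∈ P, ∀ y ∈ (Q : Subgroup K).map K.subtype,
      x * y * x⁻¹ ∈ (Q : Subgroup K).map K.subtype := by
    rintro x hx _ ⟨y, hy, rfl⟩
    have hxQ : MulAut.conjNormal (H := K) x • Q = Q := hQ ⟨_, mem_map_of_mem _ hx⟩
    refine ⟨MulAut.conjNormal x y, ?_, MulAut.conjNormal_apply x y⟩
    rw [← hxQ]
    exact smul_mem_pointwise_smul y _ (Q : Subgroup K) hy
  refine ⟨Q, fun x hx => mem_normalizer_iff.2 fun y => ⟨hconj x hx y, fun h => ?_⟩⟩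
  simpa [mul_assoc] using hconj x⁻¹ (inv_mem hx) _ h

/-- For each prime `q`, the `p`-group `P` normalizes some Sylow `q`-subgroup of `K`, hence
centralizes it; so the centralizer of `P` in `K` has full `q`-part. -/
theorem le_centralizer_of_forall_ordProj_lt {P K : Subgroup G} [K.Normal] [Finite K]
    (hP : IsPGroup p P) (hK : ∀ q, q.Prime → ordProj[q] (Nat.card K) < p) :
    P ≤ centralizer (K : Set G) := by
  have hpK : ¬p ∣ Nat.card K := not_dvd_of_ordProj_lt Nat.card_pos.ne' (hK p Fact.out)
  have hordProj (q : ℕ) (hq : q.Prime) :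
      ordProj[q] (Nat.card K) ∣ Nat.card (K ⊓ centralizer (P : Set G) : Subgroup G) := by
    have := Fact.mk hq
    obtain ⟨Q, hQ⟩ := exists_sylow_le_normalizer_map hP hpK q
    have hcard : Nat.card ((Q : Subgroup K).map K.subtype) = ordProj[q] (Nat.card K) := by
      rw [card_map_of_injective K.subtype_injective, Q.card_eq_multiplicity]
    have : Finite ((Q : Subgroup K).map K.subtype) :=
      Nat.finite_of_card_ne_zero (hcard ▸ (Nat.ordProj_pos _ _).ne')
    rw [← hcard]
    exact card_dvd_of_le (le_inf (map_subtype_le _) (le_centralizer_iff.1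
      (le_centralizer_of_le_normalizer_of_card_lt hP hQ (hcard ▸ hK q hq))))
  have : Finite (K ⊓ centralizer (P : Set G) : Subgroup G) :=
    Finite.of_injective _ (inclusion_injective inf_le_left)
  have hcard : Nat.card K ∣ Nat.card (K ⊓ centralizer (P : Set G) : Subgroup G) :=
    (Nat.dvd_iff_prime_pow_dvd_dvd _ _).2 fun q k hq hqk =>
      ((hq.pow_dvd_iff_dvd_ordProj Nat.card_pos.ne').1 hqk).trans (hordProj q hq)
  have hinf : K ⊓ centralizer (P : Set G) = K :=
    eq_of_le_of_card_ge inf_le_left (Nat.le_of_dvd Nat.card_pos hcard)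
  exact le_centralizer_iff.1 (inf_eq_left.1 hinf)

end CentralizingSubgroups

section SylowDirectFactor

open Subgroup

variable {G : Type*} [Group G] {p n : ℕ}

theorem nonempty_mulEquiv_prod_of_isComplement' {K P : Subgroup G} (h : IsComplement' K P)
    (hcomm : P ≤ centralizer (K : Set G)) : Nonempty (G ≃* K × P) :=
  ⟨(MulEquiv.ofBijective (MonoidHom.noncommCoprod K.subtype P.subtype fun k z =>
    mem_centralizer_iff.1 (hcomm z.2) k k.2) h).symm⟩

theorem sylow_le_centralizer_of_card_eq_prime [Fact p.Prime] {P : Sylow p G} (hP : Nat.card P = p) :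
    (P : Subgroup G) ≤ centralizer (P : Set G) := by
  have : IsCyclic P := isCyclic_of_prime_card hP
  exact le_centralizer (P : Subgroup G)

variable [Finite G] [Fact p.Prime]

/-- A complement of the normal subgroup `N` has order prime to `p`, so its `N.index` elements are
not counted. -/
theorem card_dvd_orderOf_add_index_le {N : Subgroup G} [N.Normal] (hN : Nat.card N = p)
    (hindex : ¬p ∣ N.index) :
    Nat.card {g : G // p ∣ orderOf g} + N.index ≤ Nat.card G := by
  obtain ⟨H, hH⟩ := exists_right_complement'_of_coprime (N := N)
    (hN ▸ (Nat.Prime.coprime_iff_not_dvd Fact.out).2 hindex)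
  rw [hH.symm.index_eq_card] at hindex ⊢
  rw [← Nat.card_sum]
  refine Nat.card_le_card_of_injective (Sum.elim Subtype.val Subtype.val)
    (Subtype.val_injective.sumElim Subtype.val_injective ?_)
  rintro ⟨g, hg⟩ ⟨h, hh⟩ rfl
  exact hindex (hg.trans (orderOf_dvd_natCard H hh))

theorem card_sylow_eq_prime (hG : Nat.card G = n * p) (hn : ¬p ∣ n) (P : Sylow p G) :
    Nat.card P = p := by
  have hp : p.Prime := Fact.out
  rw [P.card_eq_multiplicity, hG, Nat.factorization_mul (by rintro rfl; simp at hn) hp.ne_zero,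
    Finsupp.add_apply, Nat.factorization_eq_zero_of_not_dvd hn, hp.factorization_self, pow_one]

theorem exists_card_centralizer_sylow_eq_mul (hG : Nat.card G = n * p) (hn : ¬p ∣ n)
    (P : Sylow p G) :
    ∃ c, Nat.card (centralizer (P : Set G)) = c * p ∧
      Nat.card {g : centralizer (P : Set G) // p ∣ orderOf g} ≤ c * (p - 1) := by
  have hP := card_sylow_eq_prime hG hn P
  set C := centralizer (P : Set G)
  let N : Subgroup C := (P : Subgroup G).subgroupOf C
  have hN : Nat.card N = p := (Nat.card_congr
    (subgroupOfEquivOfLe (sylow_le_centralizer_of_card_eq_prime hP)).toEquiv).trans hP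
  have : N.Normal := normal_subgroupOf_of_le_normalizer (centralizer_le_normalizer _)
  have hindex : N.index * p = Nat.card C := by rw [← hN, index_mul_card]
  have hndvd : ¬p ∣ N.index := fun h =>
    hn (Nat.dvd_of_mul_dvd_mul_right (Fact.out : p.Prime).pos (hG ▸
      ((mul_dvd_mul_right h p).trans hindex.dvd).trans (card_subgroup_dvd_card C)))
  have hle := card_dvd_orderOf_add_index_le hN hndvd
  refine ⟨N.index, hindex.symm, ?_⟩
  rw [← hindex] at hle
  rw [Nat.mul_sub_one]
  omega

theorem exists_mem_centralizer_sylow (hG : Nat.card G = n * p) (hn : ¬p ∣ n) {g : G}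
    (hg : p ∣ orderOf g) : ∃ P : Sylow p G, g ∈ centralizer (P : Set G) := by
  have horder : Nat.card (zpowers (g ^ (orderOf g / p))) = p := by
    rw [Nat.card_zpowers, orderOf_pow_orderOf_div (orderOf_pos g).ne' hg]
  obtain ⟨P, hP⟩ := (IsPGroup.of_card (n := 1) (horder.trans (pow_one p).symm)).exists_le_sylow
  have heq := eq_of_le_of_card_ge hP ((card_sylow_eq_prime hG hn P).trans horder.symm).le
  refine ⟨P, mem_centralizer_iff.2 fun x hx => ?_⟩
  obtain ⟨k, rfl⟩ : x ∈ zpowers (g ^ (orderOf g / p)) := heq ▸ hx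
  exact (((Commute.refl g).pow_left _).zpow_left k).eq

theorem card_dvd_orderOf_le_sum [Fintype (Sylow p G)] (hG : Nat.card G = n * p) (hn : ¬p ∣ n) :
    Nat.card {g : G // p ∣ orderOf g} ≤
      ∑ P : Sylow p G, Nat.card {g : centralizer (P : Set G) // p ∣ orderOf g} := by
  choose P hP using fun g : {g : G // p ∣ orderOf g} => exists_mem_centralizer_sylow hG hn g.2
  rw [← Nat.card_sigma]
  refine Nat.card_le_card_of_injective (fun g => ⟨P g, ⟨g, hP g⟩, by simpa using g.2⟩)
    fun g h hgh => Subtype.ext ?_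
  exact congrArg (fun s : Σ P : Sylow p G, {g : centralizer (P : Set G) // p ∣ orderOf g} =>
    (s.2.1 : G)) hgh

/-- If `|C(P)| = c(P) p`, then `C(P)` contains at most `c(P) (p - 1)` of the elements of order
divisible by `p`; so `n ≤ ∑ c(P)`, and `c(P)` is at least the average `|N(P)| / p` for some `P`. -/
theorem exists_sylow_normalizer_le_centralizer (hG : Nat.card G = n * p) (hn : ¬p ∣ n)
    (hsing : n * (p - 1) ≤ Nat.card {g : G // p ∣ orderOf g}) :
    ∃ P : Sylow p G, normalizer (P : Set G) ≤ centralizer (P : Set G) := by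
  classical
  have := Fintype.ofFinite (Sylow p G)
  have hp : p.Prime := Fact.out
  choose c hc hcle using exists_card_centralizer_sylow_eq_mul hG hn
  have hsum : n ≤ ∑ P, c P := by
    refine Nat.le_of_mul_le_mul_right ?_ (Nat.sub_pos_of_lt hp.one_lt)
    rw [Finset.sum_mul]
    exact hsing.trans ((card_dvd_orderOf_le_sum hG hn).trans
      (Finset.sum_le_sum fun P _ => hcle P))
  obtain ⟨P, -, hP⟩ : ∃ P ∈ Finset.univ, n ≤ Nat.card (Sylow p G) * c P := by
    refine Finset.exists_le_of_sum_le Finset.univ_nonempty ?_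
    rw [← Finset.mul_sum, Finset.sum_const, Finset.card_univ, ← Nat.card_eq_fintype_card,
      smul_eq_mul]
    exact Nat.mul_le_mul_left _ hsum
  refine ⟨P, (eq_of_le_of_card_ge (centralizer_le_normalizer _) ?_).ge⟩
  refine Nat.le_of_mul_le_mul_left (c := Nat.card (Sylow p G)) ?_ Nat.card_pos
  rw [P.card_eq_index_normalizer, index_mul_card, ← P.card_eq_index_normalizer, hG, hc P,
    ← mul_assoc]
  exact Nat.mul_le_mul_right p hP

theorem exists_mulEquiv_prod_of_le_card_dvd_orderOf (hG : Nat.card G = n * p)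
    (hn : ∀ q, q.Prime → ordProj[q] n < p)
    (hsing : n * (p - 1) ≤ Nat.card {g : G // p ∣ orderOf g}) :
    ∃ K : Subgroup G, Nat.card K = n ∧ Nonempty (G ≃* K × Multiplicative (ZMod p)) := by
  have hp : p.Prime := Fact.out
  have hpn : ¬p ∣ n := not_dvd_of_ordProj_lt
    (fun h => Nat.card_pos.ne' (hG.trans (by rw [h, zero_mul]))) (hn p hp)
  obtain ⟨P, hP⟩ := exists_sylow_normalizer_le_centralizer hG hpn hsing
  have hcard := card_sylow_eq_prime hG hpn P
  have hcompl := MonoidHom.ker_transferSylow_isComplement' P hP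
  set K := (MonoidHom.transferSylow P hP).ker
  have hK : Nat.card K = n :=
    Nat.eq_of_mul_eq_mul_right hp.pos (by rw [← hG, ← hcompl.card_mul_card, hcard])
  obtain ⟨e⟩ := nonempty_mulEquiv_prod_of_isComplement' hcompl
    (le_centralizer_of_forall_ordProj_lt P.isPGroup' (hK ▸ hn))
  have eP : P ≃* Multiplicative (ZMod p) := mulEquivOfPrimeCardEq (p := p) hcard
    (by rw [Nat.card_congr Multiplicative.toAdd, Nat.card_zmod])
  exact ⟨K, hK, ⟨e.trans ((MulEquiv.refl K).prodCongr eP)⟩⟩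

end SylowDirectFactor

section Recognition

theorem ordProj_sixty_le_five {q : ℕ} (hq : q.Prime) : ordProj[q] 60 ≤ 5 := by
  by_cases h : q ∈ Nat.primeFactors 60
  · rw [primeFactors_sixty] at h
    fin_cases h
    · exact ordProj_two_sixty.trans_le (by norm_num)
    · decide +kernel
    · decide +kernel
  · rw [Nat.factorization_eq_zero_of_not_dvd fun h60 =>
      h (Nat.mem_primeFactors.2 ⟨hq, h60, by norm_num⟩)]
    norm_num

variable {p : ℕ}

theorem not_dvd_sixty (hp : p.Prime) (hp5 : 5 < p) : ¬p ∣ 60 := by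
  have := Fact.mk hp
  exact not_dvd_of_ordProj_lt (by norm_num) ((ordProj_sixty_le_five hp).trans_lt hp5)

theorem expRho_prod_eq {K Z : Type*} [Group K] [Group Z] (hp : p.Prime) (hp5 : 5 < p)
    (hK : Nat.card K = 60) (hprime : ∀ x : K, x ≠ 1 → (orderOf x).Prime) (hZ : Nat.card Z = p) :
    expRho (K × Z) = {15 * p, 20 * p, 24 * p, 60 * (p - 1)} := by
  have : Finite K := Nat.finite_of_card_ne_zero (by rw [hK]; norm_num)
  have : Finite Z := Nat.finite_of_card_ne_zero (by rw [hZ]; exact hp.ne_zero)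
  have hp60 := not_dvd_sixty hp hp5
  have hfactor (q : ℕ) (hq : q ∈ Nat.primeFactors 60) :
      (prodElementOrders (K × Z)).factorization q = (prodElementOrders K).factorization q * p := by
    rw [factorization_prodElementOrders_prod, hZ, mul_comm]
    rw [hZ, Nat.prime_dvd_prime_iff_eq (Nat.prime_of_mem_primeFactors hq) hp]
    rintro rfl
    exact hp60 (Nat.dvd_of_mem_primeFactors hq)
  have hfactor_p : (prodElementOrders (K × Z)).factorization p = 60 * (p - 1) := by
    rw [prodElementOrders_congr (MulEquiv.prodComm (M := K) (N := Z)),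
      factorization_prodElementOrders_prod (by rwa [hK]), hK,
      factorization_prodElementOrders_of_card_eq_prime hp hZ]
  obtain ⟨h2, h3, h5⟩ := (factorization_prodElementOrders_iff_orderOf_prime hK).2 hprime
  rw [expRho_eq_image, Nat.card_prod, hK, hZ, Nat.primeFactors_mul (by norm_num) hp.ne_zero,
    hp.primeFactors, Finset.image_union, Finset.image_singleton, hfactor_p,
    Finset.image_congr fun q hq => hfactor q hq, primeFactors_sixty]
  simp only [Finset.image_insert, Finset.image_singleton, h2, h3, h5, Finset.insert_union,
    Finset.singleton_union]

theorem dvd_gcd_of_dvd_mul_of_dvd_mul_sub_one {a b d t : ℕ} (hp : p.Prime) (hpt : ¬p ∣ t)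
    (ha : d ∣ a * p) (hb : d ∣ b * p) (hd : d ∣ a.gcd b * t * (p - 1)) : d ∣ a.gcd b := by
  have hgcd : d ∣ a.gcd b * p := Nat.gcd_mul_right a p b ▸ Nat.dvd_gcd ha hb
  have hmul : d ∣ a.gcd b * t := by
    have h := Nat.dvd_sub ((hgcd.mul_right t).trans (by rw [mul_right_comm])) hd
    rwa [← Nat.mul_sub, Nat.sub_sub_self hp.one_le, mul_one] at h
  have h := Nat.dvd_gcd hgcd hmul
  rwa [Nat.gcd_mul_left, (hp.coprime_iff_not_dvd).2 hpt, mul_one] at h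

variable {G : Type*} [Group G] [Finite G]

theorem mem_expRho {v : ℕ} :
    v ∈ expRho G ↔
      ∃ q, q.Prime ∧ q ∣ Nat.card G ∧ (prodElementOrders G).factorization q = v := by
  simp [expRho_eq_image, Nat.mem_primeFactors, Nat.card_pos.ne', and_assoc]

theorem ordProj_card_dvd_of_mem_expRho {r v : ℕ} (hr : r.Prime) (hv : v ∈ expRho G)
    (hne : (prodElementOrders G).factorization r ≠ v) : ordProj[r] (Nat.card G) ∣ v := by
  obtain ⟨q, hq, -, rfl⟩ := mem_expRho.1 hv
  exact ordProj_card_dvd_factorization_prodElementOrders hr hq fun h => hne (h ▸ rfl)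

/-- The `r`-part of `|G|` divides the three exponents that do not belong to `r`, and hence their
greatest common divisor. -/
theorem prime_cases_of_expRho_eq (hp : p.Prime) (hp5 : 5 < p)
    (h : expRho G = {15 * p, 20 * p, 24 * p, 60 * (p - 1)}) {r : ℕ} (hr : r.Prime)
    (hrG : r ∣ Nat.card G) :
    (r = 2 ∧ (prodElementOrders G).factorization r = 15 * p ∧ ordProj[r] (Nat.card G) ∣ 4) ∨
    (r = 3 ∧ (prodElementOrders G).factorization r = 20 * p ∧ ordProj[r] (Nat.card G) ∣ 3) ∨
    (r = 5 ∧ (prodElementOrders G).factorization r = 24 * p ∧ ordProj[r] (Nat.card G) ∣ 5) ∨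
    (r = p ∧ (prodElementOrders G).factorization r = 60 * (p - 1) ∧
      ordProj[r] (Nat.card G) ∣ p) := by
  have hp60 := not_dvd_sixty hp hp5
  have hself : r ∣ ordProj[r] (Nat.card G) := Nat.dvd_ordProj_of_dvd Nat.card_pos.ne' hr hrG
  have hdvd : ∀ v ∈ expRho G, (prodElementOrders G).factorization r ≠ v →
      ordProj[r] (Nat.card G) ∣ v := fun v => ordProj_card_dvd_of_mem_expRho hr
  simp only [h, Finset.mem_insert, Finset.mem_singleton, forall_eq_or_imp, forall_eq] at hdvd
  obtain ⟨h15, h20, h24, h60⟩ := hdvd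
  have hmem := mem_expRho.2 ⟨r, hr, hrG, rfl⟩
  simp only [h, Finset.mem_insert, Finset.mem_singleton] at hmem
  rcases hmem with hv | hv | hv | hv
  · have h4 : ordProj[r] (Nat.card G) ∣ 4 := dvd_gcd_of_dvd_mul_of_dvd_mul_sub_one (t := 15) hp
      (fun h => hp60 (h.trans (by norm_num))) (h20 (by omega)) (h24 (by omega)) (h60 (by omega))
    exact .inl ⟨(Nat.prime_dvd_prime_iff_eq hr Nat.prime_two).1
      (hr.dvd_of_dvd_pow (n := 2) (hself.trans h4)), hv, h4⟩
  · have h3 : ordProj[r] (Nat.card G) ∣ 3 := dvd_gcd_of_dvd_mul_of_dvd_mul_sub_one (t := 20) hp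
      (fun h => hp60 (h.trans (by norm_num))) (h15 (by omega)) (h24 (by omega)) (h60 (by omega))
    exact .inr (.inl ⟨(Nat.prime_dvd_prime_iff_eq hr Nat.prime_three).1 (hself.trans h3), hv, h3⟩)
  · have h5 : ordProj[r] (Nat.card G) ∣ 5 := dvd_gcd_of_dvd_mul_of_dvd_mul_sub_one (t := 12) hp
      (fun h => hp60 (h.trans (by norm_num))) (h15 (by omega)) (h20 (by omega)) (h60 (by omega))
    exact .inr (.inr (.inl
      ⟨(Nat.prime_dvd_prime_iff_eq hr Nat.prime_five).1 (hself.trans h5), hv, h5⟩))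
  · have h1 : ordProj[r] (Nat.card G) ∣ Nat.gcd (15 * p) (Nat.gcd (20 * p) (24 * p)) :=
      Nat.dvd_gcd (h15 (by omega)) (Nat.dvd_gcd (h20 (by omega)) (h24 (by omega)))
    rw [Nat.gcd_mul_right, Nat.gcd_mul_right, show Nat.gcd 15 (Nat.gcd 20 24) = 1 by norm_num,
      one_mul] at h1
    exact .inr (.inr (.inr ⟨(Nat.prime_dvd_prime_iff_eq hr hp).1 (hself.trans h1), hv, h1⟩))

theorem factorizations_of_expRho_eq (hp : p.Prime) (hp5 : 5 < p)
    (h : expRho G = {15 * p, 20 * p, 24 * p, 60 * (p - 1)}) :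
    (prodElementOrders G).factorization 2 = 15 * p ∧
      (prodElementOrders G).factorization 3 = 20 * p ∧
      (prodElementOrders G).factorization 5 = 24 * p ∧
      (prodElementOrders G).factorization p = 60 * (p - 1) := by
  have hattained (v : ℕ) (hv : v ∈ expRho G) :
      ((prodElementOrders G).factorization 2 = v ∧ v = 15 * p) ∨
      ((prodElementOrders G).factorization 3 = v ∧ v = 20 * p) ∨
      ((prodElementOrders G).factorization 5 = v ∧ v = 24 * p) ∨
      ((prodElementOrders G).factorization p = v ∧ v = 60 * (p - 1)) := by
    obtain ⟨q, hq, hqG, rfl⟩ := mem_expRho.1 hv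
    rcases prime_cases_of_expRho_eq hp hp5 h hq hqG with
      ⟨rfl, hv, -⟩ | ⟨rfl, hv, -⟩ | ⟨rfl, hv, -⟩ | ⟨rfl, hv, -⟩ <;> simp [hv]
  have h15 := hattained (15 * p) (by simp [h])
  have h20 := hattained (20 * p) (by simp [h])
  have h24 := hattained (24 * p) (by simp [h])
  have h60 := hattained (60 * (p - 1)) (by simp [h])
  omega

theorem card_dvd_sixty_mul_of_expRho_eq (hp : p.Prime) (hp5 : 5 < p)
    (h : expRho G = {15 * p, 20 * p, 24 * p, 60 * (p - 1)}) : Nat.card G ∣ 60 * p := by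
  refine (Nat.dvd_iff_prime_pow_dvd_dvd _ _).2 fun r k hr hk => ?_
  rcases k.eq_zero_or_pos with rfl | hk0
  · simp
  refine ((hr.pow_dvd_iff_dvd_ordProj Nat.card_pos.ne').1 hk).trans ?_
  rcases prime_cases_of_expRho_eq hp hp5 h hr ((dvd_pow_self r hk0.ne').trans hk) with
    ⟨-, -, hd⟩ | ⟨-, -, hd⟩ | ⟨-, -, hd⟩ | ⟨-, -, hd⟩
  · exact hd.trans (Dvd.dvd.mul_right (by norm_num) p)
  · exact hd.trans (Dvd.dvd.mul_right (by norm_num) p)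
  · exact hd.trans (Dvd.dvd.mul_right (by norm_num) p)
  · exact hd.trans (dvd_mul_left p 60)

theorem card_dvd_orderOf_of_expRho_eq (hp : p.Prime) (hp5 : 5 < p)
    (h : expRho G = {15 * p, 20 * p, 24 * p, 60 * (p - 1)}) :
    Nat.card {g : G // p ∣ orderOf g} = 60 * (p - 1) := by
  rw [← (factorizations_of_expRho_eq hp hp5 h).2.2.2,
    factorization_prodElementOrders_eq_card hp]
  refine ((Nat.factorization_le_iff_dvd Nat.card_pos.ne' (by simp [hp.ne_zero])).2
    (card_dvd_sixty_mul_of_expRho_eq hp hp5 h) p).trans_eq ?_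
  rw [Nat.factorization_mul (by norm_num) hp.ne_zero, Finsupp.add_apply, hp.factorization_self,
    Nat.factorization_eq_zero_of_not_dvd (not_dvd_sixty hp hp5)]

theorem card_eq_of_expRho_eq (hp : p.Prime) (hp5 : 5 < p)
    (h : expRho G = {15 * p, 20 * p, 24 * p, 60 * (p - 1)}) : Nat.card G = 60 * p := by
  have hle : 60 * (p - 1) ≤ Nat.card G := by
    rw [← card_dvd_orderOf_of_expRho_eq hp hp5 h]
    exact Nat.card_le_card_of_injective _ Subtype.val_injective
  obtain ⟨c, hc⟩ := card_dvd_sixty_mul_of_expRho_eq hp hp5 h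
  have hc0 : c ≠ 0 := by
    rintro rfl
    omega
  have hc2 : c < 2 := by
    by_contra! hc2
    have := Nat.mul_le_mul hle hc2
    omega
  rw [hc, show c = 1 by omega, mul_one]

theorem exists_mulEquiv_prod_of_expRho_eq (hp : p.Prime) (hp5 : 5 < p)
    (h : expRho G = {15 * p, 20 * p, 24 * p, 60 * (p - 1)}) :
    ∃ K : Subgroup G, Nat.card K = 60 ∧ (∀ x : K, x ≠ 1 → (orderOf x).Prime) ∧
      Nonempty (G ≃* K × Multiplicative (ZMod p)) := by
  have := Fact.mk hp
  obtain ⟨K, hK, ⟨e⟩⟩ := exists_mulEquiv_prod_of_le_card_dvd_orderOf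
    (card_eq_of_expRho_eq hp hp5 h) (fun q hq => (ordProj_sixty_le_five hq).trans_lt hp5)
    (card_dvd_orderOf_of_expRho_eq hp hp5 h).ge
  refine ⟨K, hK, (factorization_prodElementOrders_iff_orderOf_prime hK).1 ?_, ⟨e⟩⟩
  have hZ : Nat.card (Multiplicative (ZMod p)) = p := by
    rw [Nat.card_congr Multiplicative.toAdd, Nat.card_zmod]
  have hcancel {q v : ℕ} (hq : q.Prime) (hqp : q ≠ p)
      (hv : (prodElementOrders G).factorization q = v * p) :
      (prodElementOrders K).factorization q = v := by
    rw [prodElementOrders_congr e, factorization_prodElementOrders_prod (by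
      rwa [hZ, Nat.prime_dvd_prime_iff_eq hq hp]), hZ, mul_comm] at hv
    exact Nat.eq_of_mul_eq_mul_right hp.pos hv
  obtain ⟨h2, h3, h5, -⟩ := factorizations_of_expRho_eq hp hp5 h
  exact ⟨hcancel Nat.prime_two (by omega) h2, hcancel Nat.prime_three (by omega) h3,
    hcancel Nat.prime_five hp5.ne h5⟩

end Recognition

theorem mainTheorem1 (p : ℕ) (hp : p.Prime) (hp5 : 5 < p) :
    expRho (Matrix.ProjectiveSpecialLinearGroup (Fin 2) (ZMod 5) × Multiplicative (ZMod p)) =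
        {15 * p, 20 * p, 24 * p, 60 * (p - 1)} ∧
      ∀ (G : Type*) [Group G] [Finite G],
        Nonempty (G ≃*
            Matrix.ProjectiveSpecialLinearGroup (Fin 2) (ZMod 5) × Multiplicative (ZMod p)) ↔
          expRho G =
            expRho
              (Matrix.ProjectiveSpecialLinearGroup (Fin 2) (ZMod 5) × Multiplicative (ZMod p)) :=
  by
  have hS := card_projectiveSpecialLinearGroup_two_five
  have hprime := orderOf_prime_projectiveSpecialLinearGroup_two_five
  have hexp := expRho_prod_eq hp hp5 hS hprime
    (show Nat.card (Multiplicative (ZMod p)) = p by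
      rw [Nat.card_congr Multiplicative.toAdd, Nat.card_zmod])
  refine ⟨hexp, fun G _ _ => ⟨fun ⟨e⟩ => expRho_congr e, fun h => ?_⟩⟩
  obtain ⟨K, hK, hKprime, ⟨e⟩⟩ := exists_mulEquiv_prod_of_expRho_eq hp hp5 (h.trans hexp)
  obtain ⟨eK⟩ := nonempty_mulEquiv_alternatingGroup_five hK hKprime
  obtain ⟨eS⟩ := nonempty_mulEquiv_alternatingGroup_five hS hprime
  exact ⟨e.trans ((eK.trans eS.symm).prodCongr (MulEquiv.refl _))⟩
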